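/- Let $K$ be an algebraically closed field of characteristic $0$, and let $u,h\in K[x,y]$ and $v\in K[x,y,z]$ be polynomials such that the polynomial map $H=(u(x,y),\,v(x,y,z),\,h(x,y))$ over $K[x,y,z]$ satisfies $H(0)=0$. Assume that $u,v,h$ are linearly independent over $K$ and that the Jacobian matrix $JH$ of $H$ with respect to $(x,y,z)$ is nilpotent. Write $\deg_y f$ for the highest degree of $y$ in $f$. If $\deg_y u\le 7$, or $\deg_y u=9$, or $\deg_y h\le 7$, or $\deg_y h=9$, then there are $v_1,c_0,a\in K\setminus\{0\}$, $l_1,l_2,\tilde l_2\in K$ and a polynomial $g(t)\in K[t]$ with $g(0)=0$ and $\deg_t g\ge 1$ such that, with $b(x)=v_1c_0a\,x^2+l_1x+\tilde l_2$, $$u=g(ay+b(x)),\qquad v=v_1z-a^{-1}b'(x)\,g(ay+b(x))-v_1l_2x,\qquad h=c_0u^2+l_2u.$$ -/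

import Mathlib

/-- The Jacobian matrix `(∂Hᵢ/∂xⱼ)` of a polynomial map `H : Kⁿ → Kⁿ`. -/
noncomputable def polyJacobian {K : Type*} [Field K] {n : ℕ}
    (H : Fin n → MvPolynomial (Fin n) K) : Matrix (Fin n) (Fin n) (MvPolynomial (Fin n) K) :=
  Matrix.of fun i j => MvPolynomial.pderiv j (H i)

/-- The shape of the map `(u, v, h)` in the classification. The variables `x, y, z` are
`X 0, X 1, X 2`; `g` and `b` are polynomials in one variable, so that
`aeval (X 0) b` is `b(x)`, `aeval (X 0) b.derivative` is `b'(x)` and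
`aeval (C a * X 1 + aeval (X 0) b) g` is `g(ay + b(x))`. -/
def HasClassifiedForm {K : Type*} [Field K] (u v h : MvPolynomial (Fin 3) K) : Prop :=
  ∃ (v₁ c₀ a l₁ l₂ l₂' : K) (b g : Polynomial K),
    v₁ ≠ 0 ∧ c₀ ≠ 0 ∧ a ≠ 0 ∧
    g.eval 0 = 0 ∧ 1 ≤ g.natDegree ∧
    b = Polynomial.C (v₁ * c₀ * a) * Polynomial.X ^ 2 + Polynomial.C l₁ * Polynomial.X
          + Polynomial.C l₂' ∧
    u = Polynomial.aeval
          (MvPolynomial.C a * MvPolynomial.X 1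
            + Polynomial.aeval (MvPolynomial.X 0 : MvPolynomial (Fin 3) K) b) g ∧
    v = MvPolynomial.C v₁ * MvPolynomial.X 2
          - MvPolynomial.C a⁻¹
            * Polynomial.aeval (MvPolynomial.X 0 : MvPolynomial (Fin 3) K)
                (Polynomial.derivative b)
            * Polynomial.aeval
                (MvPolynomial.C a * MvPolynomial.X 1
                  + Polynomial.aeval (MvPolynomial.X 0 : MvPolynomial (Fin 3) K) b) g
          - MvPolynomial.C (v₁ * l₂) * MvPolynomial.X 0 ∧
    h = MvPolynomial.C c₀ * u ^ 2 + MvPolynomial.C l₂ * u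

/-! ### Derivations on a fraction field. -/

section

open Polynomial

/-! Write subscripts for partial derivatives. Nilpotency says that the trace, the sum of the
principal 2-minors and the determinant of the Jacobian vanish. Differentiating these equations in
`z` shows that `v_z` is a constant `v₁` (`exists_pderiv_two_eq_C`), so `v = v₁ z + q(x, y)`; after
replacing `h` by `v₁ h`, a system in two variables remains.

Let `s = -u_x / u_y` and `δ = ∂_x + s ∂_y`. In the coordinates `(x, u)`, `δ` is `∂_x` and `D = u_y⁻¹
∂_y` is `∂_u`, so they commute. The system reads `s = D q`, `δ q = -D h`, `δ h = 0`; hence `δ s =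
-D² h` and `δ² s = 0`. The flow of `δ` is therefore quadratic in time and preserves `u`. This makes
its `y`-component integral over `K[x, y]`, so `s` is a polynomial (`exists_polynomial_slope`). A
degree count then forces `s` to depend on `x` only (`eq_C_of_transport_transport_eq_zero`).

With `s = -β'(x)`, `u` is a polynomial in `y + β(x)`, and the remaining equations give `β''' = 0`
and `h` quadratic in `u` (`exists_normal_form`). Linear independence makes `v₁` and the quadratic
coefficient nonzero. -/

theorem Derivation.exists_extension_isLocalization {K R L : Type*} [CommRing K] [CommRing R]
    [CommRing L] [Algebra K R] [Algebra K L] [Algebra R L] [IsScalarTower K R L]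
    (M : Submonoid R) [IsLocalization M L] (d : Derivation K R R) :
    ∃ D : Derivation K L L, ∀ r, D (algebraMap R L r) = algebraMap R L (d r) := by
  -- A localization is formally étale, so its Kähler differentials are a base change and `d` lifts.
  have := Algebra.FormallyEtale.of_isLocalization (Rₘ := L) M
  have hb := KaehlerDifferential.isBaseChange_of_formallyEtale K R L
  refine ⟨(hb.lift ((Algebra.linearMap R L).comp d.liftKaehlerDifferential)).compDer
    (KaehlerDifferential.D K L), fun r => ?_⟩
  have := hb.lift_eq ((Algebra.linearMap R L).comp d.liftKaehlerDifferential)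
    (KaehlerDifferential.D K R r)
  simpa using this

theorem Derivation.eq_zero_of_isFractionRing {K R L : Type*} [CommRing K] [CommRing R] [IsDomain R]
    [Field L] [Algebra K R] [Algebra K L] [Algebra R L] [IsScalarTower K R L] [IsFractionRing R L]
    (D : Derivation K L L) (h : ∀ r, D (algebraMap R L r) = 0) : D = 0 := by
  ext a
  obtain ⟨p, q, hq, rfl⟩ := IsFractionRing.div_surjective (A := R) a
  have hq' : algebraMap R L q ≠ 0 := by simpa using nonZeroDivisors.ne_zero hq
  have h1 := D.leibniz (algebraMap R L p / algebraMap R L q) (algebraMap R L q)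
  rw [div_mul_cancel₀ _ hq', h, h] at h1
  simpa [hq'] using h1.symm

theorem Derivation.apply_div {K L : Type*} [CommRing K] [Field L] [Algebra K L]
    (D : Derivation K L L) (a b : L) (hb : b ≠ 0) : D (a / b) = (D a * b - a * D b) / b ^ 2 := by
  have h1 := D.leibniz (a / b) b
  rw [div_mul_cancel₀ _ hb] at h1
  simp only [smul_eq_mul] at h1
  rw [h1]
  field_simp
  ring

/-! ### The slope of the level curves of `u`. -/

section Hodograph

variable {K L : Type*} [CommRing K] [Field L] [Algebra K L] (X Y : Derivation K L L)

/-- The operators `X + s Y` and `(Y u)⁻¹ Y` commute, as partial derivatives in the coordinates `(x,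
u)`. -/
theorem transport_div_eq_zero {s u f : L} (hXY : ∀ a, X (Y a) = Y (X a)) (hu0 : Y u ≠ 0)
    (hu : X u + s * Y u = 0) (hf : X f + s * Y f = 0) :
    X (Y f / Y u) + s * Y (Y f / Y u) = 0 := by
  have h1 := congrArg Y hu
  have h2 := congrArg Y hf
  simp only [map_add, Derivation.leibniz, smul_eq_mul, map_zero, ← hXY] at h1 h2
  rw [X.apply_div _ _ hu0, Y.apply_div _ _ hu0]
  field_simp
  linear_combination Y u * h2 - Y f * h1

theorem transport_transport_slope_eq_zero {s u q h : L} (hXY : ∀ a, X (Y a) = Y (X a))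
    (hu0 : Y u ≠ 0) (hs : X u + s * Y u = 0) (hq : Y q = - X u)
    (hm : X u * Y q - Y u * X q = Y h) (hj : X u * Y h = Y u * X h) :
    X (X s + s * Y s) + s * Y (X s + s * Y s) = 0 := by
  have hh : X h + s * Y h = 0 := by
    apply mul_left_cancel₀ hu0
    linear_combination Y h * hs - hj
  have hr := transport_div_eq_zero X Y hXY hu0 hs hh
  have hw := transport_div_eq_zero X Y hXY hu0 hs hr
  have hqr : X q + s * Y q = - (Y h / Y u) := by
    field_simp
    linear_combination Y q * hs - hm
  have hsq : s = Y q / Y u := by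
    field_simp
    linear_combination hs - hq
  -- With `D = (Y u)⁻¹ Y` and `δ = X + s Y`, this is `δ D q = D δ q = -D (D h)`.
  have hδs : X s + s * Y s = - (Y (Y h / Y u) / Y u) := by
    have h1 := congrArg Y hs
    have h2 := congrArg Y hqr
    simp only [map_add, map_neg, Derivation.leibniz, smul_eq_mul, map_zero, ← hXY] at h1 h2
    have hsq' : s * Y u = Y q := by linear_combination hs - hq
    have h3 := congrArg X hsq'
    have h4 := congrArg Y hsq'
    simp only [Derivation.leibniz, smul_eq_mul] at h3 h4
    rw [eq_neg_iff_add_eq_zero]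
    apply mul_left_cancel₀ hu0
    rw [mul_add, mul_div_cancel₀ _ hu0]
    linear_combination h3 + s * h4 - s * h1 + h2 + Y s * hsq'
  rw [hδs]
  simp only [map_neg]
  linear_combination -hw

end Hodograph

/-- The derivation `∂/∂x` of `K[x][y]`. -/
noncomputable def Polynomial.partialX (K : Type*) [CommRing K] : Derivation K K[X][X] K[X][X] :=
  PolynomialModule.equivPolynomialSelf.compDer derivative'.mapCoeffs

/-- The derivation `∂/∂y` of `K[x][y]`. -/
noncomputable def Polynomial.partialY (K : Type*) [CommRing K] : Derivation K K[X][X] K[X][X] :=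
  (derivative' (R := K[X])).restrictScalars K

/-! ### Partial derivatives on `K[x][y]`. -/

section

variable {K : Type*} [CommRing K]

@[simp] theorem coeff_partialX (f : K[X][X]) (n : ℕ) :
    (partialX K f).coeff n = derivative (f.coeff n) := rfl

theorem partialY_apply (f : K[X][X]) : partialY K f = derivative f := rfl

@[simp] theorem coeff_partialY (f : K[X][X]) (n : ℕ) :
    (partialY K f).coeff n = f.coeff (n + 1) * (n + 1) := by
  rw [partialY_apply, coeff_derivative]

@[simp] theorem partialX_C (p : K[X]) : partialX K (C p) = C (derivative p) := by
  ext1 n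
  rw [coeff_partialX, coeff_C, coeff_C]
  split_ifs <;> simp

@[simp] theorem partialX_X : partialX K X = 0 := by
  ext1 n
  rw [coeff_partialX, coeff_X]
  split_ifs <;> simp

@[simp] theorem partialY_C (p : K[X]) : partialY K (C p) = 0 := by
  simp [partialY_apply]

@[simp] theorem partialY_X : partialY K X = 1 := by
  simp [partialY_apply]

theorem partialX_partialY (f : K[X][X]) :
    partialX K (partialY K f) = partialY K (partialX K f) := by
  ext1 n
  simp [derivative_mul]

theorem eq_C_of_partialY_eq_zero [IsDomain K] [CharZero K] {f : K[X][X]} (h : partialY K f = 0) :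
    f = C (f.coeff 0) :=
  eq_C_of_derivative_eq_zero h

theorem eq_map_C_of_partialX_eq_zero [IsDomain K] [CharZero K] {f : K[X][X]}
    (h : partialX K f = 0) : ∃ g : K[X], f = g.map C := by
  refine ⟨f.map (evalRingHom 0), ?_⟩
  ext1 n
  have h1 : derivative (f.coeff n) = 0 := by rw [← coeff_partialX, h, coeff_zero]
  rw [eq_C_of_derivative_eq_zero h1, coeff_map, coeff_map, eq_C_of_derivative_eq_zero h1]
  simp

end

/-! ### The quadratic flow of a derivation. -/

section Flow

variable {K L : Type*} [Field K] [Field L] [CharZero L] [Algebra K L] [Algebra K[X][X] L]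
  [IsScalarTower K K[X][X] L]

/-- If a derivation `δ` satisfies `δ x = 1` and `δ³ y = 0` then its flow is
`x ↦ x + T`, `y ↦ y + (δ y) T + (δ² y) T² / 2`; its invariants `u` are unchanged by it. -/
theorem aeval_flow_of_derivation_eq_zero (δ : Derivation K L L)
    (hx : δ (algebraMap K[X][X] L (C X)) = 1)
    (hy : δ (δ (δ (algebraMap K[X][X] L X))) = 0) (u : K[X][X])
    (hu : δ (algebraMap K[X][X] L u) = 0) (c : K) :
    aeval (algebraMap K[X][X] L X
        + δ (algebraMap K[X][X] L X) * (algebraMap K L c - algebraMap K[X][X] L (C X))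
        + δ (δ (algebraMap K[X][X] L X)) / 2
          * (algebraMap K L c - algebraMap K[X][X] L (C X)) ^ 2)
      (u.map (evalRingHom c)) = algebraMap K[X][X] L u := by
  set x := algebraMap K[X][X] L (C X)
  set y := algebraMap K[X][X] L X
  let _ : Differential L := ⟨δ.restrictScalars ℤ⟩
  have hδ : ∀ a : L, Differential.deriv a = δ a := fun a => rfl
  -- `Φ f` is `f` along the flow, as a polynomial in the time `T`.
  let Φ : K[X][X] →+* L[X] := eval₂RingHom
    (eval₂RingHom (algebraMap K L[X]) (C x + X)) (C y + C (δ y) * X + C (δ (δ y) / 2) * X ^ 2)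
  have h2 : δ (δ (δ y) / 2) = 0 := by
    rw [δ.apply_div _ _ two_ne_zero, hy]
    have : δ 2 = 0 := by exact_mod_cast δ.map_natCast 2
    simp [this]
  -- The flow equation `d/dT = δ`, with `δ` acting on coefficients; both sides are derivations along
  -- `Φ`, so generators suffice.
  have hder : ∀ f, derivative (Φ f) = Differential.mapCoeffs (Φ f) := by
    have hC : ∀ p : K[X], derivative (Φ (C p)) = Differential.mapCoeffs (Φ (C p)) := by
      intro p
      induction p using Polynomial.induction_on' with
      | add p q hp hq => simp only [map_add, hp, hq]
      | monomial n a =>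
        rw [← C_mul_X_pow_eq_monomial]
        have h3 : Φ (C (C a)) = C (algebraMap K L a) := by simp [Φ]
        have h4 : Φ (C X) = C x + X := by simp [Φ]
        simp only [map_mul, map_pow, h3, h4, derivative_mul, derivative_pow, Derivation.leibniz,
          Derivation.leibniz_pow, derivative_C, map_add, Differential.mapCoeffs_C,
          Differential.mapCoeffs_X, hδ, δ.map_algebraMap, hx, derivative_X]
        simp
    intro f
    induction f using Polynomial.induction_on' with
    | add p q hp hq => simp only [map_add, hp, hq]
    | monomial n a =>
      rw [← C_mul_X_pow_eq_monomial]
      have h4 : Φ X = C y + C (δ y) * X + C (δ (δ y) / 2) * X ^ 2 := by simp [Φ]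
      have h5 : derivative (Φ X) = Differential.mapCoeffs (Φ X) := by
        rw [h4]
        simp only [derivative_mul, derivative_pow, Derivation.leibniz, map_add,
          Derivation.leibniz_pow, derivative_C, Differential.mapCoeffs_C,
          Differential.mapCoeffs_X, hδ, h2, derivative_X]
        have : (C (δ (δ y) / 2) : L[X]) * C 2 = C (δ (δ y)) := by
          rw [← C_mul, div_mul_cancel₀ _ two_ne_zero]
        simp [← this]
        ring
      simp only [map_mul, map_pow, derivative_mul, derivative_pow, Derivation.leibniz,
          Derivation.leibniz_pow, hC, h5]
      simp
      ring
  have h0 : ∀ f, (Φ f).coeff 0 = algebraMap K[X][X] L f := by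
    intro f
    have : (evalRingHom 0).comp Φ = algebraMap K[X][X] L := by
      ext a
      · simpa [Φ] using IsScalarTower.algebraMap_apply K K[X][X] L a
      · simp [Φ, x]
      · simp [Φ, y]
    rw [coeff_zero_eq_eval_zero, ← this]
    rfl
  have hcoeff : ∀ n, (Φ u).coeff (n + 1) = 0 := by
    have hstep : ∀ n, δ ((Φ u).coeff n) = 0 → (Φ u).coeff (n + 1) = 0 := by
      intro n hn
      have h6 := congrArg (fun p => p.coeff n) (hder u)
      simp only [coeff_derivative, Differential.coeff_mapCoeffs, hδ, hn] at h6
      exact (mul_eq_zero.mp h6).resolve_right (by exact_mod_cast Nat.succ_ne_zero n)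
    intro n
    induction n with
    | zero => exact hstep 0 (by rw [h0, hu])
    | succ n ih => exact hstep _ (by rw [ih, map_zero])
  have hΦu : Φ u = C (algebraMap K[X][X] L u) := by
    ext n
    cases n with
    | zero => simp [h0]
    | succ n => simp [hcoeff]
  -- At time `T = c - x` the flow reaches the line `x = c`.
  have h7 := congrArg (eval (algebraMap K L c - x)) hΦu
  rw [eval_C] at h7
  rw [← h7, Polynomial.aeval_def, eval₂_map, ← coe_evalRingHom, ← RingHom.comp_apply,
    ← coe_eval₂RingHom]
  congr 1
  ext a
  · simp [Φ]
  · simp [Φ]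
  · simp [Φ]

end Flow

/-! ### The slope is a polynomial in `x` alone. -/

section

variable {K : Type*} [Field K]

/-- Dividing by the leading coefficient of `g` shows that `a` is integral over `R`, which is
integrally closed. -/
theorem exists_algebraMap_eq_of_aeval_eq {R L : Type*} [CommRing R] [IsDomain R] [Field L]
    [Algebra K R] [Algebra K L] [Algebra R L] [IsScalarTower K R L] [IsFractionRing R L]
    [IsIntegrallyClosed R] (g : K[X]) (hg : g.natDegree ≠ 0) (a : L) (r : R)
    (h : aeval a g = algebraMap R L r) : ∃ b : R, algebraMap R L b = a := by
  have hg0 : g.leadingCoeff ≠ 0 := by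
    rintro h0
    rw [leadingCoeff_eq_zero] at h0
    simp [h0] at hg
  set g' := g * C g.leadingCoeff⁻¹ with hg'
  have hmon : g'.Monic := monic_mul_leadingCoeff_inv (leadingCoeff_ne_zero.mp hg0)
  have hdeg : g'.natDegree ≠ 0 := by
    rwa [hg', natDegree_mul_C (inv_ne_zero hg0)]
  have hint : IsIntegral R a := by
    refine IsIntegral.of_aeval_monic (p := g'.map (algebraMap K R)) (hmon.map _) ?_ ?_
    · rwa [hmon.natDegree_map]
    · rw [aeval_map_algebraMap, hg', map_mul, h, aeval_C, IsScalarTower.algebraMap_apply K R L,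
        ← map_mul]
      exact isIntegral_algebraMap
  exact IsIntegrallyClosed.isIntegral_iff.mp hint

theorem exists_polynomial_slope_of_isFractionRing [CharZero K] (L : Type*) [Field L] [CharZero L]
    [Algebra K L] [Algebra K[X][X] L] [IsScalarTower K K[X][X] L] [IsFractionRing K[X][X] L]
    {u q h : K[X][X]} (hu : partialY K u ≠ 0)
    (hq : partialY K q = - partialX K u)
    (hm : partialX K u * partialY K q - partialY K u * partialX K q = partialY K h)
    (hj : partialX K u * partialY K h = partialY K u * partialX K h) :
    ∃ s w : K[X][X], partialX K u + s * partialY K u = 0 ∧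
      partialX K s + s * partialY K s = w ∧ partialX K w + s * partialY K w = 0 := by
  set ι := algebraMap K[X][X] L
  have hι : Function.Injective ι := IsFractionRing.injective _ _
  obtain ⟨A, hA⟩ := Derivation.exists_extension_isLocalization (L := L) (nonZeroDivisors K[X][X])
    (partialX K)
  obtain ⟨B, hB⟩ := Derivation.exists_extension_isLocalization (L := L) (nonZeroDivisors K[X][X])
    (partialY K)
  change ∀ r, A (ι r) = ι _ at hA
  change ∀ r, B (ι r) = ι _ at hB
  have hAB : ∀ a, A (B a) = B (A a) := by
    have : ⁅A, B⁆ = 0 := by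
      apply Derivation.eq_zero_of_isFractionRing (R := K[X][X])
      intro r
      change ⁅A, B⁆ (ι r) = 0
      rw [Derivation.commutator_apply, hA, hB, hB, hA, partialX_partialY, sub_self]
    intro a
    have h1 := congrArg (fun D => D a) this
    simpa [Derivation.commutator_apply, sub_eq_zero] using h1
  have hu0 : B (ι u) ≠ 0 := by
    rw [hB]
    exact (map_ne_zero_iff ι hι).mpr hu
  set σ : L := - A (ι u) / B (ι u) with hσ
  have hs : A (ι u) + σ * B (ι u) = 0 := by
    rw [hσ, div_mul_cancel₀ _ hu0, add_neg_cancel]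
  have hd := transport_transport_slope_eq_zero A B (q := ι q) (h := ι h) hAB hu0 hs
    (by rw [hA, hB, hq, map_neg])
    (by simp only [hA, hB, ← map_mul, ← map_sub, hm])
    (by simp only [hA, hB, ← map_mul, hj])
  let δ : Derivation K L L := A + σ • B
  have hδ : ∀ a, δ a = A a + σ * B a := fun a => rfl
  set x := ι (C X)
  set y := ι X
  have hx : δ x = 1 := by simp [hδ, x, hA, hB]
  have hy : δ y = σ := by simp [hδ, y, hA, hB]
  have hy3 : δ (δ (δ y)) = 0 := by rw [hy, hδ, hδ, hd]
  have hflow := aeval_flow_of_derivation_eq_zero δ hx hy3 u (by rw [hδ]; exact hs)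
  change ∀ c : K, aeval (y + δ y * (algebraMap K L c - x) + δ (δ y) / 2 *
    (algebraMap K L c - x) ^ 2) (u.map (evalRingHom c)) = ι u at hflow
  rw [hy] at hflow
  have hmem : ∀ c : K, ∃ b, ι b = y + σ * (algebraMap K L c - x) + δ σ / 2 *
      (algebraMap K L c - x) ^ 2 := by
    intro c
    refine exists_algebraMap_eq_of_aeval_eq (u.map (evalRingHom c)) ?_ _ u (hflow c)
    -- If `u(c, y)` were constant, the flow identity would make `u` constant.
    intro h0
    have h1 := hflow c
    rw [eq_C_of_natDegree_eq_zero h0, aeval_C, IsScalarTower.algebraMap_apply K K[X][X] L] at h1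
    apply hu
    rw [← hι h1]
    exact Derivation.map_algebraMap _ _
  -- The expression is quadratic in `c`: its second difference at `0, 1, -1` is `δ σ`, and `(b₁ -
  -- b₂) / 2 = σ - x δ σ`.
  obtain ⟨b₀, h₀⟩ := hmem 0
  obtain ⟨b₁, h₁⟩ := hmem 1
  obtain ⟨b₂, h₂⟩ := hmem (-1)
  simp only [map_zero, map_one, map_neg] at h₀ h₁ h₂
  have hw : ι (b₁ + b₂ - 2 * b₀) = δ σ := by
    simp only [map_sub, map_add, map_mul, h₀, h₁, h₂, map_ofNat]
    ring
  have hhalf : ι (C (C (1 / 2))) + ι (C (C (1 / 2))) = 1 := by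
    have h2 : (C (C (1 / 2 : K)) + C (C (1 / 2)) : K[X][X]) = 1 := by
      rw [← C_add, ← C_add, add_halves, C_1, C_1]
    rw [← map_add, h2, map_one]
  have hs' : ι (C (C (1 / 2)) * (b₁ - b₂) + C X * (b₁ + b₂ - 2 * b₀)) = σ := by
    rw [map_add, map_mul, map_mul, hw, map_sub, h₁, h₂]
    change _ + x * δ σ = σ
    linear_combination (σ - x * δ σ) * hhalf
  refine ⟨C (C (1 / 2)) * (b₁ - b₂) + C X * (b₁ + b₂ - 2 * b₀), b₁ + b₂ - 2 * b₀,
    hι ?_, hι ?_, hι ?_⟩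
  · rw [map_add, map_mul, ← hA, ← hB, hs', hs, map_zero]
  · rw [map_add, map_mul, ← hA, ← hB, hs', hw, hδ]
  · rw [map_add, map_mul, ← hA, ← hB, hs', hw, hδ, hd, map_zero]

theorem exists_polynomial_slope [CharZero K] {u q h : K[X][X]} (hu : partialY K u ≠ 0)
    (hq : partialY K q = - partialX K u)
    (hm : partialX K u * partialY K q - partialY K u * partialX K q = partialY K h)
    (hj : partialX K u * partialY K h = partialY K u * partialX K h) :
    ∃ s w : K[X][X], partialX K u + s * partialY K u = 0 ∧
      partialX K s + s * partialY K s = w ∧ partialX K w + s * partialY K w = 0 :=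
  have : CharZero (FractionRing K[X][X]) := charZero_of_injective_algebraMap
    (IsFractionRing.injective K[X][X] (FractionRing K[X][X]))
  exists_polynomial_slope_of_isFractionRing (FractionRing K[X][X]) hu hq hm hj

/-- Let `d = deg_y s`. If `d ≥ 2`, then `deg_y w = 2d - 1`, while `s w_y` has degree `3d - 2`, too
large to cancel `w_x`. If `d = 1`, the leading coefficient `a(x)` satisfies `a'' + 3 a a' + a³ = 0`,
which has no nonzero polynomial solution. -/
theorem eq_C_of_transport_transport_eq_zero [CharZero K] {s w : K[X][X]}
    (hw : partialX K s + s * partialY K s = w) (hw' : partialX K w + s * partialY K w = 0) :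
    s = C (s.coeff 0) := by
  apply eq_C_of_natDegree_eq_zero
  by_contra hd
  have hdX : ∀ f : K[X][X], (partialX K f).natDegree ≤ f.natDegree := by
    intro f
    rw [natDegree_le_iff_coeff_eq_zero]
    intro n hn
    rw [coeff_partialX, coeff_eq_zero_of_natDegree_lt hn, derivative_zero]
  have hs0 : s ≠ 0 := by
    rintro rfl
    simp at hd
  have hds : (partialY K s).natDegree = s.natDegree - 1 := by
    rw [partialY_apply, natDegree_derivative]
  rcases lt_or_ge 1 s.natDegree with h1 | h1
  · have hs1 : partialY K s ≠ 0 := by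
      intro h
      have := eq_C_of_partialY_eq_zero h
      rw [this] at hd
      simp at hd
    have hp : (s * partialY K s).natDegree = 2 * s.natDegree - 1 := by
      rw [natDegree_mul hs0 hs1, hds]
      omega
    have hwd : w.natDegree = 2 * s.natDegree - 1 := by
      rw [← hw, natDegree_add_eq_right_of_natDegree_lt, hp]
      rw [hp]
      exact (hdX s).trans_lt (by omega)
    have hw1 : partialY K w ≠ 0 := by
      intro h
      have := eq_C_of_partialY_eq_zero h
      rw [this, natDegree_C] at hwd
      omega
    have h2 : (s * partialY K w).natDegree = 3 * s.natDegree - 2 := by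
      rw [natDegree_mul hs0 hw1, partialY_apply, natDegree_derivative, hwd]
      omega
    have h3 : s * partialY K w = - partialX K w := by linear_combination hw'
    have h4 := hdX w
    rw [h3, natDegree_neg] at h2
    omega
  · have h1' : s.natDegree = 1 := by omega
    obtain ⟨a, b, hab⟩ := exists_eq_X_add_C_of_natDegree_le_one h1
    have ha : a ≠ 0 := by
      rintro rfl
      rw [hab] at h1'
      simp at h1'
    obtain ⟨c, hc⟩ : ∃ c, c = derivative a + a ^ 2 := ⟨_, rfl⟩
    have hwe : w = C c * X + C (derivative b + a * b) := by
      rw [← hw, hab, hc]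
      simp
      ring
    rw [hwe, hab] at hw'
    have h5 := congrArg (fun p => p.coeff 1) hw'
    simp [coeff_C, add_mul] at h5
    rw [hc, derivative_add, sq, derivative_mul] at h5
    -- Differentiation lowers degree, so divisibility by `a` kills first `a''`, then `a'`.
    have hdvd : ∀ p : K[X], a ∣ derivative p → p.natDegree ≤ a.natDegree → derivative p = 0 := by
      intro p hp hpd
      by_contra hne
      have h6 := natDegree_le_of_dvd hp hne
      have h7 : p.natDegree ≠ 0 := by
        intro h
        rw [eq_C_of_natDegree_eq_zero h, derivative_C] at hne
        exact hne rfl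
      have := natDegree_derivative_lt h7
      omega
    have h8 : derivative (derivative a) = 0 := by
      apply hdvd
      · exact ⟨-(3 * derivative a + a ^ 2), by linear_combination h5⟩
      · exact (natDegree_derivative_le a).trans (by omega)
    have h9 : 3 * derivative a + a ^ 2 = 0 := by
      apply (mul_eq_zero.mp (_ : a * (3 * derivative a + a ^ 2) = 0)).resolve_left ha
      linear_combination h5 - h8
    have h10 : derivative a = 0 := by
      apply hdvd _ _ le_rfl
      refine ⟨C (-1 / 3) * a, ?_⟩
      have h11 : (C (-1 / 3) * 3 : K[X]) = -1 := by
        rw [← C_ofNat, ← C_mul]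
        simp
      linear_combination derivative a * h11 - C (-1 / 3) * h9
    rw [h10, mul_zero, zero_add] at h9
    exact ha (pow_eq_zero_iff two_ne_zero |>.mp h9)

end

/-! ### Normal form in two variables. -/

section

variable {K : Type*} [Field K]

theorem partialX_comp (f p : K[X][X]) :
    partialX K (f.comp p) = (partialX K f).comp p + (partialY K f).comp p * partialX K p := by
  induction f using Polynomial.induction_on' with
  | add f g hf hg => simp only [add_comp, map_add, hf, hg]; ring
  | monomial n a =>
    rw [← C_mul_X_pow_eq_monomial]
    simp [Derivation.leibniz_pow]
    ring

theorem Polynomial.exists_derivative_eq [CharZero K] (f : K[X]) : ∃ p, derivative p = f := by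
  induction f using Polynomial.induction_on' with
  | add f g hf hg =>
    obtain ⟨p, rfl⟩ := hf
    obtain ⟨q, rfl⟩ := hg
    exact ⟨p + q, derivative_add⟩
  | monomial n a =>
    refine ⟨monomial (n + 1) (a / (n + 1)), ?_⟩
    rw [derivative_monomial, Nat.add_sub_cancel, Nat.cast_add_one,
      div_mul_cancel₀ _ (by exact_mod_cast Nat.succ_ne_zero n)]

/-- The shear `y ↦ y - β(x)` straightens the characteristics, leaving a polynomial free of `x`. -/
theorem exists_eq_comp_of_transport_eq_zero [CharZero K] {f : K[X][X]} {β : K[X]}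
    (hf : partialX K f = C (derivative β) * partialY K f) :
    ∃ g : K[X], f = (g.map C).comp (X + C β) := by
  obtain ⟨g, hg⟩ := eq_map_C_of_partialX_eq_zero (f := f.comp (X - C β)) (by
    rw [partialX_comp, hf]
    simp
    ring)
  refine ⟨g, ?_⟩
  rw [← hg, comp_assoc]
  simp

theorem eq_zero_of_partial_eq_zero [CharZero K] {f : K[X][X]} (hx : partialX K f = 0)
    (hy : partialY K f = 0) (h0 : f.evalEval 0 0 = 0) : f = 0 := by
  have h1 := eq_C_of_partialY_eq_zero hy
  rw [h1, partialX_C, C_eq_zero] at hx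
  rw [h1, evalEval_C, eq_C_of_derivative_eq_zero hx, eval_C] at h0
  rw [h1, eq_C_of_derivative_eq_zero hx, h0, C_0, C_0]

theorem exists_normal_form [CharZero K] {u q h : K[X][X]} (hu : partialY K u ≠ 0)
    (hq : partialY K q = - partialX K u)
    (hm : partialX K u * partialY K q - partialY K u * partialX K q = partialY K h)
    (hj : partialX K u * partialY K h = partialY K u * partialX K h)
    (hu0 : u.evalEval 0 0 = 0) (hq0 : q.evalEval 0 0 = 0) (hh0 : h.evalEval 0 0 = 0) :
    ∃ (κ l l₁ : K) (β g : K[X]), β = C κ * X ^ 2 + C l₁ * X ∧ g.eval 0 = 0 ∧ 1 ≤ g.natDegree ∧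
      u = (g.map C).comp (X + C β) ∧ q = C (C l * X) - C (derivative β) * u ∧
      h = C (C κ) * u ^ 2 - C (C l) * u := by
  obtain ⟨s, w, hs, hw, hw'⟩ := exists_polynomial_slope hu hq hm hj
  obtain ⟨p, hp⟩ := Polynomial.exists_derivative_eq (- s.coeff 0)
  set β := p - C (p.eval 0) with hβ
  have hβ0 : β.eval 0 = 0 := by simp [hβ]
  have hβs : C (derivative β) = - s := by
    rw [eq_C_of_transport_transport_eq_zero hw hw', hβ]
    simp [hp]
  have hux : partialX K u = C (derivative β) * partialY K u := by
    rw [hβs]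
    linear_combination hs
  have hhx : partialX K h = C (derivative β) * partialY K h := by
    apply mul_left_cancel₀ hu
    rw [← hj, hux]
    ring
  have hqe : partialY K (q + C (derivative β) * u) = 0 := by
    simp only [map_add, Derivation.leibniz, partialY_C, smul_eq_mul, mul_zero, hq, hux]
    ring
  obtain ⟨e, he⟩ : ∃ e, q = C e - C (derivative β) * u :=
    ⟨_, eq_sub_of_add_eq (eq_C_of_partialY_eq_zero hqe)⟩
  have hcomm : ∀ f, partialX K f = C (derivative β) * partialY K f →
      partialX K (partialY K f) = C (derivative β) * partialY K (partialY K f) := by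
    intro f hf
    rw [partialX_partialY, hf]
    simp
  have hmain : partialY K u * (C (derivative (derivative β)) * u - C (derivative e)) =
      partialY K h := by
    rw [← hm, he]
    simp only [map_sub, Derivation.leibniz, partialY_C, partialX_C, smul_eq_mul, hux]
    ring
  -- Apply `∂_x - β' ∂_y` to `hmain`: it kills `u`, `u_y` and `h_y`.
  have h1 : C (derivative (derivative (derivative β))) * u = C (derivative (derivative e)) := by
    have h2 := congrArg (partialX K) hmain
    have h3 := congrArg (partialY K) hmain
    rw [hcomm h hhx] at h2
    simp only [map_sub, Derivation.leibniz, partialY_C, partialX_C, smul_eq_mul, hcomm u hux,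
      hux] at h2 h3
    rw [← sub_eq_zero]
    apply (mul_eq_zero.mp (_ : partialY K u * _ = 0)).resolve_left hu
    linear_combination h2 - C (derivative β) * h3
  -- The right side of `h1` is free of `y`, whereas `u_y ≠ 0`.
  have h2 : derivative (derivative (derivative β)) = 0 := by
    have h3 := congrArg (partialY K) h1
    simp only [Derivation.leibniz, partialY_C, smul_eq_mul, mul_zero, add_zero] at h3
    exact C_eq_zero.mp ((mul_eq_zero.mp h3).resolve_right hu)
  have h3 : derivative (derivative e) = 0 := by
    rw [h2, C_0, zero_mul] at h1
    exact C_eq_zero.mp h1.symm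
  obtain ⟨k, hk⟩ : ∃ k, derivative (derivative β) = C k := ⟨_, eq_C_of_derivative_eq_zero h2⟩
  obtain ⟨l, hl⟩ : ∃ l, derivative e = C l := ⟨_, eq_C_of_derivative_eq_zero h3⟩
  have he' : e = C l * X := by
    have h4 : derivative (e - C l * X) = 0 := by simp [hl]
    have h5 := eq_C_of_derivative_eq_zero h4
    have h6 : e.eval 0 = 0 := by
      rw [he] at hq0
      simpa [evalEval_sub, evalEval_mul, evalEval_C, hu0] using hq0
    rw [← coeff_zero_eq_eval_zero] at h6
    simpa [h6, sub_eq_zero] using h5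
  have hβ' : ∃ l₁, β = C (k / 2) * X ^ 2 + C l₁ * X := by
    have h4 : derivative (derivative β - C k * X) = 0 := by simp [hk]
    obtain ⟨l₁, hl₁⟩ : ∃ l₁, derivative β - C k * X = C l₁ := ⟨_, eq_C_of_derivative_eq_zero h4⟩
    refine ⟨l₁, ?_⟩
    have h5 : derivative (β - (C (k / 2) * X ^ 2 + C l₁ * X)) = 0 := by
      have h6 : (C (k / 2) * 2 : K[X]) = C k := by
        rw [← C_ofNat, ← C_mul, div_mul_cancel₀ _ two_ne_zero]
      rw [derivative_sub, derivative_add, derivative_C_mul, derivative_C_mul, derivative_X_sq,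
        derivative_X, C_ofNat]
      linear_combination hl₁ - X * h6
    have h6 := eq_C_of_derivative_eq_zero h5
    rw [← coeff_zero_eq_eval_zero] at hβ0
    simpa [hβ0, sub_eq_zero] using h6
  obtain ⟨l₁, hl₁⟩ := hβ'
  obtain ⟨g, hg⟩ := exists_eq_comp_of_transport_eq_zero hux
  have hg0 : g.eval 0 = 0 := by
    rw [hg] at hu0
    simp [evalEval, eval_map] at hu0
    change eval 0 (g.comp β) = 0 at hu0
    simpa [eval_comp, hβ0] using hu0
  refine ⟨k / 2, l, l₁, β, g, hl₁, hg0, ?_, hg, ?_, ?_⟩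
  · by_contra hlt
    rw [eq_C_of_natDegree_eq_zero (p := g) (by omega)] at hg
    apply hu
    rw [hg]
    simp
  · rw [he, he']
  · have hhalf : (C (C (k / 2)) + C (C (k / 2)) : K[X][X]) = C (C k) := by
      rw [← C_add, ← C_add, add_halves]
    rw [hk, hl] at hmain
    rw [← sub_eq_zero]
    have hy : partialY K (h - (C (C (k / 2)) * u ^ 2 - C (C l) * u)) = 0 := by
      simp only [sq, map_sub, Derivation.leibniz, partialY_C, smul_eq_mul]
      linear_combination - hmain - partialY K u * u * hhalf
    have hx : partialX K (h - (C (C (k / 2)) * u ^ 2 - C (C l) * u)) = 0 := by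
      simp only [sq, map_sub, Derivation.leibniz, partialX_C, derivative_C, C_0, smul_eq_mul, hux,
        hhx]
      simp only [sq, map_sub, Derivation.leibniz, partialY_C, smul_eq_mul] at hy
      linear_combination C (derivative β) * hy
    apply eq_zero_of_partial_eq_zero hx hy
    simp [evalEval_sub, evalEval_mul, evalEval_pow, hu0, hh0]

end

end

namespace MvPolynomial

/-! ### Partial derivatives of multivariate polynomials. -/

section

variable {K σ : Type*} [CommRing K]

theorem pderiv_comm (i j : σ) (f : MvPolynomial σ K) :
    pderiv i (pderiv j f) = pderiv j (pderiv i f) := by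
  classical
  have : ⁅(pderiv i : Derivation K (MvPolynomial σ K) (MvPolynomial σ K)), pderiv j⁆ = (0 : Derivation K (MvPolynomial σ K) (MvPolynomial σ K)) := by
    apply derivation_ext
    intro k
    simp only [Derivation.commutator_apply, pderiv_X, Pi.single_apply]
    split_ifs <;> simp
  have h := congrArg (fun D => D f) this
  simpa [Derivation.commutator_apply, sub_eq_zero] using h

theorem exists_iterate_pderiv_eq_zero (i : σ) (f : MvPolynomial σ K) :
    ∃ n, (pderiv i)^[n] f = 0 := by
  have key : ∀ n, ∀ f : MvPolynomial σ K, (∀ m ∈ f.support, m i < n) → (pderiv i)^[n] f = 0 := by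
    intro n
    induction n with
    | zero =>
      intro f hf
      rw [Function.iterate_zero_apply, ← support_eq_empty, Finset.eq_empty_iff_forall_notMem]
      exact fun m hm => absurd (hf m hm) (Nat.not_lt_zero _)
    | succ n ih =>
      intro f hf
      rw [Function.iterate_succ_apply]
      apply ih
      intro m hm
      rw [mem_support_iff, coeff_pderiv] at hm
      have := hf (m + Finsupp.single i 1) (mem_support_iff.mpr (left_ne_zero_of_mul hm))
      simpa using this
  refine ⟨f.degreeOf i + 1, key _ f fun m hm => ?_⟩
  exact Nat.lt_succ_of_le (monomial_le_degreeOf i hm)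

variable [IsDomain K] [CharZero K]

theorem notMem_vars_of_pderiv_eq_zero {i : σ} {f : MvPolynomial σ K} (h : pderiv i f = 0) :
    i ∉ f.vars := by
  classical
  rw [mem_vars_iff_mem_support]
  rintro ⟨m, hm, hi⟩
  have h1 : 1 ≤ m i := Nat.one_le_iff_ne_zero.mpr (Finsupp.mem_support_iff.mp hi)
  have hle : Finsupp.single i 1 ≤ m := Finsupp.single_le_iff.mpr h1
  have h2 := congrArg (coeff (m - Finsupp.single i 1)) h
  rw [coeff_pderiv, tsub_add_cancel_of_le hle, coeff_zero] at h2
  refine mem_support_iff.mp hm ((mul_eq_zero.mp h2).resolve_right ?_)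
  exact Nat.cast_add_one_ne_zero _

theorem eq_C_of_pderiv_eq_zero {f : MvPolynomial σ K} (h : ∀ i, pderiv i f = 0) :
    ∃ c, f = C c := by
  have : f ∈ supported K (∅ : Set σ) := by
    rw [mem_supported]
    exact fun i hi => absurd hi (notMem_vars_of_pderiv_eq_zero (h i))
  rw [supported_empty, Algebra.mem_bot] at this
  obtain ⟨c, hc⟩ := this
  exact ⟨c, hc.symm⟩

end

/-! ### Linearity of `v` in `z`. -/

section

variable {K : Type*} [Field K] [CharZero K]

/-- The last nonzero `z`-derivative of `v` is a constant `c`. If its order were at least 2, the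
equation one order lower would give `∇h = γ ∇u` with `γ` constant, making `h` affine in `u`. -/
theorem exists_pderiv_two_eq_C {u v h : MvPolynomial (Fin 3) K} (hu : pderiv 2 u = 0)
    (hh : pderiv 2 h = 0) (hu0 : pderiv 1 u ≠ 0) (htr : pderiv 0 u + pderiv 1 v = 0)
    (hm : pderiv 0 u * pderiv 1 v - pderiv 1 u * pderiv 0 v = pderiv 2 v * pderiv 1 h)
    (hj : pderiv 2 v * (pderiv 0 u * pderiv 1 h - pderiv 1 u * pderiv 0 h) = 0)
    (hind : ∀ c d, h ≠ C c * u + C d) : ∃ c, pderiv 2 v = C c := by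
  classical
  obtain ⟨n, hn, hmin⟩ : ∃ n, (pderiv 2)^[n] v = 0 ∧ ∀ m < n, (pderiv 2)^[m] v ≠ 0 :=
    ⟨_, Nat.find_spec (exists_iterate_pderiv_eq_zero 2 v),
      fun m => Nat.find_min (exists_iterate_pderiv_eq_zero 2 v)⟩
  set a : ℕ → MvPolynomial (Fin 3) K := fun k => (pderiv 2)^[k] v with ha
  have hsucc : ∀ k, pderiv 2 (a k) = a (k + 1) := fun k =>
    (Function.iterate_succ_apply' _ k v).symm
  have hz : ∀ {f : MvPolynomial (Fin 3) K} (i), pderiv 2 f = 0 → pderiv 2 (pderiv i f) = 0 := by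
    intro f i hf
    rw [pderiv_comm, hf, map_zero]
  have hay : ∀ k, pderiv 1 (a (k + 1)) = 0 := by
    intro k
    induction k with
    | zero =>
      rw [← hsucc, ← pderiv_comm, show pderiv 1 (a 0) = -pderiv 0 u from
        eq_neg_of_add_eq_zero_right htr, map_neg, hz 0 hu, neg_zero]
    | succ k ih => rw [← hsucc, ← pderiv_comm, ih, map_zero]
  -- This is `hm` differentiated `k + 1` times in `z`; the term with `v_y` drops out by `hay`.
  have hax : ∀ k, - (pderiv 1 u * pderiv 0 (a (k + 1))) = a (k + 2) * pderiv 1 h := by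
    intro k
    induction k with
    | zero =>
      have h1 := congrArg (pderiv 2) hm
      simp only [map_sub, Derivation.leibniz, smul_eq_mul, hz _ hu, hz _ hh, pderiv_comm 2 _ v]
        at h1
      rw [show pderiv 2 v = a 1 from rfl, hay 0, hsucc 1] at h1
      linear_combination h1
    | succ k ih =>
      have h1 := congrArg (pderiv 2) ih
      simp only [map_neg, Derivation.leibniz, smul_eq_mul, hz _ hu, hz _ hh,
        pderiv_comm 2 _ (a _), hsucc] at h1
      linear_combination h1
  rcases n with _ | _ | n
  · exact ⟨0, by rw [show v = 0 from hn]; simp⟩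
  · exact ⟨0, by rw [C_0]; exact hn⟩
  have hcst : ∃ c, a (n + 1) = C c := by
    apply eq_C_of_pderiv_eq_zero
    have h1 := hax n
    rw [show a (n + 2) = 0 from hn, zero_mul, neg_eq_zero] at h1
    intro i
    fin_cases i
    · exact (mul_eq_zero.mp h1).resolve_left hu0
    · exact hay n
    · exact (hsucc _).trans hn
  obtain ⟨c, hc⟩ := hcst
  have hc0 : c ≠ 0 := by
    rintro rfl
    exact hmin (n + 1) (by omega) (by rw [C_0] at hc; exact hc)
  rcases n with _ | n
  · exact ⟨c, hc⟩
  exfalso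
  have hvz : pderiv 2 v ≠ 0 := hmin 1 (by omega)
  have hj' := (mul_eq_zero.mp hj).resolve_left hvz
  set γ := C (-c⁻¹) * pderiv 0 (a (n + 1)) with hγ
  have hcc : (C (-c⁻¹) * C c : MvPolynomial (Fin 3) K) = -1 := by
    rw [← C_mul]
    simp [hc0]
  have hhy : pderiv 1 h = γ * pderiv 1 u := by
    have h1 := hax n
    rw [hc] at h1
    rw [hγ]
    linear_combination C (-c⁻¹) * h1 + pderiv 1 h * hcc
  have hhx : pderiv 0 h = γ * pderiv 0 u := by
    apply mul_left_cancel₀ hu0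
    linear_combination pderiv 0 u * hhy - hj'
  have hγy : pderiv 1 γ = 0 := by
    rw [hγ, pderiv_C_mul, pderiv_comm, hay, map_zero, mul_zero]
  have hγz : pderiv 2 γ = 0 := by
    rw [hγ, pderiv_C_mul, pderiv_comm, hsucc, hc, pderiv_C, mul_zero]
  -- Compare the two mixed second derivatives of `h`.
  have hγx : pderiv 0 γ = 0 := by
    have h1 := congrArg (pderiv 0) hhy
    have h2 := congrArg (pderiv 1) hhx
    rw [pderiv_comm 0 1] at h1
    simp only [Derivation.leibniz, smul_eq_mul, hγy, pderiv_comm 0 1 u] at h1 h2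
    apply (mul_eq_zero.mp (_ : pderiv 1 u * pderiv 0 γ = 0)).resolve_left hu0
    linear_combination h2 - h1
  obtain ⟨c', hc'⟩ := eq_C_of_pderiv_eq_zero (f := γ) (by
    intro i
    fin_cases i
    · exact hγx
    · exact hγy
    · exact hγz)
  obtain ⟨d, hd⟩ := eq_C_of_pderiv_eq_zero (f := h - C c' * u) (by
    intro i
    fin_cases i
    · simp [hhx, hc']
    · simp [hhy, hc']
    · simp [hh, hu])
  exact hind c' d (by rw [← hd]; ring)

end

/-! ### Passage between `K[x][y]` and `K[x, y, z]`. -/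

section

variable {K : Type*} [Field K]

/-- The inclusion of `K[x][y]` into `K[x, y, z]`. -/
noncomputable def ofBivariate (K : Type*) [Field K] :
    Polynomial (Polynomial K) →+* MvPolynomial (Fin 3) K :=
  Polynomial.eval₂RingHom (Polynomial.aeval (X 0 : MvPolynomial (Fin 3) K)).toRingHom (X 1)

theorem ofBivariate_C (p : Polynomial K) :
    ofBivariate K (Polynomial.C p) = Polynomial.aeval (X 0) p := by
  simp [ofBivariate]

theorem ofBivariate_X : ofBivariate K Polynomial.X = X 1 := by
  simp [ofBivariate]

theorem ofBivariate_C_C (a : K) : ofBivariate K (Polynomial.C (Polynomial.C a)) = C a := by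
  rw [ofBivariate_C, Polynomial.aeval_C]
  rfl

theorem ofBivariate_injective : Function.Injective (ofBivariate K) := by
  let F : MvPolynomial (Fin 3) K →ₐ[K] Polynomial (Polynomial K) :=
    aeval ![Polynomial.C Polynomial.X, Polynomial.X, 0]
  have h : F.toRingHom.comp (ofBivariate K) = RingHom.id _ := by
    ext a
    · simp [ofBivariate_C_C, F]
    · simp [ofBivariate_C, F]
    · simp [ofBivariate_X, F]
  exact Function.LeftInverse.injective (g := F) fun f => RingHom.congr_fun h f

theorem exists_ofBivariate_eq {f : MvPolynomial (Fin 3) K} (hf : f ∈ supported K {0, 1}) :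
    ∃ p, ofBivariate K p = f := by
  rw [supported_eq_adjoin_X] at hf
  induction hf using Algebra.adjoin_induction with
  | mem x hx =>
    obtain ⟨i, hi, rfl⟩ := hx
    rcases hi with rfl | rfl
    · exact ⟨Polynomial.C Polynomial.X, by simp [ofBivariate_C]⟩
    · exact ⟨Polynomial.X, ofBivariate_X⟩
  | algebraMap r => exact ⟨_, ofBivariate_C_C r⟩
  | add x y _ _ hx hy =>
    obtain ⟨p, rfl⟩ := hx
    obtain ⟨q, rfl⟩ := hy
    exact ⟨p + q, map_add _ _ _⟩
  | mul x y _ _ hx hy =>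
    obtain ⟨p, rfl⟩ := hx
    obtain ⟨q, rfl⟩ := hy
    exact ⟨p * q, map_mul _ _ _⟩

theorem pderiv_zero_ofBivariate (p : Polynomial (Polynomial K)) :
    pderiv 0 (ofBivariate K p) = ofBivariate K (Polynomial.partialX K p) := by
  induction p using Polynomial.induction_on' with
  | add p q hp hq => simp only [map_add, hp, hq]
  | monomial n a =>
    rw [← Polynomial.C_mul_X_pow_eq_monomial]
    simp [Derivation.leibniz, Derivation.leibniz_pow, ofBivariate_C, ofBivariate_X]
    ring

theorem pderiv_one_ofBivariate (p : Polynomial (Polynomial K)) :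
    pderiv 1 (ofBivariate K p) = ofBivariate K (Polynomial.partialY K p) := by
  induction p using Polynomial.induction_on' with
  | add p q hp hq => simp only [map_add, hp, hq]
  | monomial n a =>
    rw [← Polynomial.C_mul_X_pow_eq_monomial]
    simp [Derivation.leibniz, Derivation.leibniz_pow, ofBivariate_C, ofBivariate_X,
      Derivation.map_aeval]

theorem eval_zero_ofBivariate (p : Polynomial (Polynomial K)) :
    eval 0 (ofBivariate K p) = p.evalEval 0 0 := by
  have h : (eval 0).comp (ofBivariate K) = Polynomial.evalEvalRingHom 0 0 := by
    ext a
    · simp [ofBivariate_C_C]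
    · simp [ofBivariate_C]
    · simp [ofBivariate_X]
  exact RingHom.congr_fun h p

theorem ofBivariate_map_C_comp (g β : Polynomial K) :
    ofBivariate K ((g.map Polynomial.C).comp (Polynomial.X + Polynomial.C β)) =
      Polynomial.aeval (X 1 + Polynomial.aeval (X 0) β) g := by
  induction g using Polynomial.induction_on' with
  | add p q hp hq => simp only [Polynomial.map_add, Polynomial.add_comp, map_add, hp, hq]
  | monomial n a =>
    rw [← Polynomial.C_mul_X_pow_eq_monomial]
    simp [ofBivariate_C, ofBivariate_X]

end

end MvPolynomial

/-! ### From nilpotency to the classification. -/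

section

open MvPolynomial

/-- The traces of `J` and `J²` and the determinant vanish; `(tr J)² - tr J²` is twice the sum of the
principal 2-minors, hence `hchar`. -/
theorem jacobian_equations_of_isNilpotent {K : Type*} [Field K] {u v h : MvPolynomial (Fin 3) K}
    (hu : pderiv 2 u = 0) (hh : pderiv 2 h = 0)
    (hnil : IsNilpotent (polyJacobian ![u, v, h])) (hchar : (2 : K) ≠ 0) :
    pderiv 0 u + pderiv 1 v = 0 ∧
    pderiv 0 u * pderiv 1 v - pderiv 1 u * pderiv 0 v = pderiv 2 v * pderiv 1 h ∧
    pderiv 2 v * (pderiv 0 u * pderiv 1 h - pderiv 1 u * pderiv 0 h) = 0 := by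
  have h1 := (Matrix.isNilpotent_trace_of_isNilpotent hnil).eq_zero
  have h2 := (Matrix.isNilpotent_trace_of_isNilpotent
    ((Commute.refl _).isNilpotent_mul_left hnil)).eq_zero
  have h3 : (polyJacobian ![u, v, h]).det = 0 := by
    obtain ⟨n, hn⟩ := hnil
    have h4 := congrArg Matrix.det hn
    rw [Matrix.det_pow, Matrix.det_zero] at h4
    exact eq_zero_of_pow_eq_zero h4
  simp [polyJacobian, Matrix.trace_fin_three, hh] at h1
  simp [polyJacobian, Matrix.trace_fin_three, Matrix.mul_apply, Fin.sum_univ_three, hu, hh] at h2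
  simp [polyJacobian, Matrix.det_fin_three, hu, hh] at h3
  refine ⟨h1, ?_, ?_⟩
  · have h4 : (2 : MvPolynomial (Fin 3) K) ≠ 0 := by
      rw [← map_ofNat (C : K →+* MvPolynomial (Fin 3) K) 2]
      exact (map_ne_zero_iff _ (C_injective _ _)).mpr hchar
    apply mul_left_cancel₀ h4
    linear_combination (pderiv 0 u + pderiv 1 v) * h1 - h2
  · linear_combination - h3

theorem hasClassifiedForm_of_normal_form {K : Type*} [Field K] {u v h : MvPolynomial (Fin 3) K}
    {v₁ κ l l₁ : K} {β g : Polynomial K} (hv₁ : v₁ ≠ 0) (hκ : κ ≠ 0)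
    (hβ : β = Polynomial.C κ * Polynomial.X ^ 2 + Polynomial.C l₁ * Polynomial.X)
    (hg0 : g.eval 0 = 0) (hg : 1 ≤ g.natDegree)
    (hu : u = Polynomial.aeval (X 1 + Polynomial.aeval (X 0) β) g)
    (hv : v = C v₁ * X 2 + (C l * X 0 - Polynomial.aeval (X 0) (Polynomial.derivative β) * u))
    (hh : C v₁ * h = C κ * u ^ 2 - C l * u) : HasClassifiedForm u v h := by
  -- The normalization `a = 1` and zero constant term of `b` suffices.
  refine ⟨v₁, κ / v₁, 1, l₁, - l / v₁, 0, β, g, hv₁, div_ne_zero hκ hv₁, one_ne_zero, hg0, hg, ?_,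
    ?_, ?_, ?_⟩
  · rw [hβ, mul_one, mul_div_cancel₀ _ hv₁, Polynomial.C_0, add_zero]
  · simpa using hu
  · rw [hv, mul_div_cancel₀ _ hv₁]
    simp only [C_1, one_mul, inv_one, ← hu, C_neg]
    ring
  · have h1 : (C v₁ : MvPolynomial (Fin 3) K) ≠ 0 :=
      (map_ne_zero_iff _ (C_injective _ _)).mpr hv₁
    apply mul_left_cancel₀ h1
    rw [hh, mul_add, ← mul_assoc, ← mul_assoc, ← C_mul, ← C_mul, mul_div_cancel₀ _ hv₁,
      mul_div_cancel₀ _ hv₁, C_neg]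
    ring

theorem hasClassifiedForm_of_isNilpotent {K : Type*} [Field K] [CharZero K]
    {u v h : MvPolynomial (Fin 3) K}
    (hu : u ∈ supported K ({0, 1} : Set (Fin 3))) (hh : h ∈ supported K ({0, 1} : Set (Fin 3)))
    (h0 : ∀ i, eval (0 : Fin 3 → K) (![u, v, h] i) = 0)
    (hind : LinearIndependent K ![u, v, h]) (hnil : IsNilpotent (polyJacobian ![u, v, h])) :
    HasClassifiedForm u v h := by
  have hu0 : eval 0 u = 0 := h0 0
  have hv0 : eval 0 v = 0 := h0 1
  have hh0 : eval 0 h = 0 := h0 2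
  have hind' : ∀ a b c : K, C a * u + C b * v + C c * h = 0 → a = 0 ∧ b = 0 ∧ c = 0 := by
    intro a b c habc
    have h1 := Fintype.linearIndependent_iff.mp hind ![a, b, c]
      (by simpa [Fin.sum_univ_three, smul_eq_C_mul] using habc)
    exact ⟨h1 0, h1 1, h1 2⟩
  have hz : ∀ {f : MvPolynomial (Fin 3) K}, f ∈ supported K ({0, 1} : Set (Fin 3)) →
      pderiv 2 f = 0 := by
    intro f hf
    apply pderiv_eq_zero_of_notMem_vars
    intro h2
    simpa using mem_supported.mp hf h2
  obtain ⟨htr, hm, hj⟩ := jacobian_equations_of_isNilpotent (hz hu) (hz hh) hnil two_ne_zero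
  -- If `u_y = 0`, the three equations give `u_x³ = 0`, so `u` is constant, hence `0`.
  have huy : pderiv 1 u ≠ 0 := by
    intro huy
    rw [huy] at hm hj
    have hux : pderiv 0 u = 0 := by
      have h1 : pderiv 0 u ^ 3 = 0 := by
        linear_combination (pderiv 0 u) ^ 2 * htr - pderiv 0 u * hm - hj
      exact pow_eq_zero_iff three_ne_zero |>.mp h1
    obtain ⟨c, hc⟩ := eq_C_of_pderiv_eq_zero (f := u) (by
      intro i
      fin_cases i
      · exact hux
      · exact huy
      · exact hz hu)
    rw [hc, eval_C] at hu0
    have h1 := hind' 1 0 0 (by simp [hc, hu0])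
    exact one_ne_zero h1.1
  obtain ⟨v₁, hv₁⟩ := exists_pderiv_two_eq_C (hz hu) (hz hh) huy htr hm hj (by
    intro c d hcd
    have hd : d = 0 := by
      have h1 := congrArg (eval 0) hcd
      rw [hh0, map_add, map_mul, hu0, mul_zero, zero_add, eval_C] at h1
      exact h1.symm
    have h1 := hind' c 0 (-1) (by simp [hcd, hd])
    exact one_ne_zero (neg_eq_zero.mp h1.2.2))
  have hq : v - C v₁ * X 2 ∈ supported K ({0, 1} : Set (Fin 3)) := by
    rw [mem_supported]
    intro i hi
    fin_cases i
    · simp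
    · simp
    · exact absurd hi (notMem_vars_of_pderiv_eq_zero (by simp [hv₁]))
  obtain ⟨u', hu'⟩ := exists_ofBivariate_eq hu
  obtain ⟨h', hh'⟩ := exists_ofBivariate_eq hh
  obtain ⟨q, hq'⟩ := exists_ofBivariate_eq hq
  have hinj := ofBivariate_injective (K := K)
  have hqx : ofBivariate K (Polynomial.partialX K q) = pderiv 0 v := by
    rw [← pderiv_zero_ofBivariate, hq']
    simp
  have hqy : ofBivariate K (Polynomial.partialY K q) = pderiv 1 v := by
    rw [← pderiv_one_ofBivariate, hq']
    simp
  have hux : ofBivariate K (Polynomial.partialX K u') = pderiv 0 u := by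
    rw [← pderiv_zero_ofBivariate, hu']
  have huy' : ofBivariate K (Polynomial.partialY K u') = pderiv 1 u := by
    rw [← pderiv_one_ofBivariate, hu']
  have hH : ofBivariate K (Polynomial.C (Polynomial.C v₁) * h') = C v₁ * h := by
    rw [map_mul, ofBivariate_C_C, hh']
  have hHx : ofBivariate K (Polynomial.partialX K (Polynomial.C (Polynomial.C v₁) * h')) =
      C v₁ * pderiv 0 h := by
    rw [← pderiv_zero_ofBivariate, hH, pderiv_C_mul]
  have hHy : ofBivariate K (Polynomial.partialY K (Polynomial.C (Polynomial.C v₁) * h')) =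
      C v₁ * pderiv 1 h := by
    rw [← pderiv_one_ofBivariate, hH, pderiv_C_mul]
  -- Using `v₁ h` in place of `h` absorbs the factor `v_z` and also covers `v₁ = 0`.
  obtain ⟨κ, l, l₁, β, g, hβ, hg0, hg, hug, hqg, hhg⟩ := exists_normal_form (u := u') (q := q)
    (h := Polynomial.C (Polynomial.C v₁) * h')
    (fun h1 => huy (by rw [← huy', h1, map_zero]))
    (hinj (by rw [map_neg, hqy, hux]; linear_combination htr))
    (hinj (by simp only [map_sub, map_mul (ofBivariate K) (Polynomial.partialX K u'),
      map_mul (ofBivariate K) (Polynomial.partialY K u'), hux, huy', hqx, hqy, hHy, hm, hv₁]))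
    (hinj (by
      rw [map_mul, map_mul (ofBivariate K), hux, huy', hHx, hHy]
      rw [hv₁] at hj
      linear_combination hj))
    (by rw [← eval_zero_ofBivariate, hu', hu0])
    (by rw [← eval_zero_ofBivariate, hq', map_sub, hv0]; simp)
    (by rw [← eval_zero_ofBivariate, hH, map_mul, hh0, mul_zero])
  have hue : u = Polynomial.aeval (X 1 + Polynomial.aeval (X 0) β) g := by
    rw [← hu', hug, ofBivariate_map_C_comp]
  have hve : v = C v₁ * X 2 +
      (C l * X 0 - Polynomial.aeval (X 0) (Polynomial.derivative β) * u) := by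
    have h1 := congrArg (ofBivariate K) hqg
    rw [hq', map_sub, map_mul (ofBivariate K), ofBivariate_C, ofBivariate_C, hu', map_mul,
      Polynomial.aeval_C, Polynomial.aeval_X] at h1
    rw [← sub_eq_iff_eq_add', h1]
    rfl
  have hhe : C v₁ * h = C κ * u ^ 2 - C l * u := by
    have h1 := congrArg (ofBivariate K) hhg
    rwa [hH, map_sub, map_mul, map_mul (ofBivariate K), map_pow, ofBivariate_C_C,
      ofBivariate_C_C, hu'] at h1
  -- If `v₁ = 0`, then `κ u² = l u` with `u` nonconstant forces `κ = l = 0`, so `v = -l₁ u`, against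
  -- independence.
  by_cases hv₁0 : v₁ = 0
  · exfalso
    rw [hv₁0, C_0, zero_mul] at hhe hve
    have hune : u ≠ 0 := by
      rintro rfl
      exact huy (map_zero _)
    have h1 : C κ * u - C l = 0 := by
      apply (mul_eq_zero.mp (_ : u * (C κ * u - C l) = 0)).resolve_left hune
      linear_combination - hhe
    have hκ : κ = 0 := by
      have h2 := congrArg (pderiv 1) h1
      simpa [huy] using h2
    have hl : l = 0 := by simpa [hκ] using h1
    have h2 := hind' l₁ 1 0 (by
      rw [hve, hβ, hκ, hl]
      simp)
    exact one_ne_zero h2.2.1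
  · refine hasClassifiedForm_of_normal_form hv₁0 ?_ hβ hg0 hg hue hve hhe
    rintro rfl
    exact hv₁0 (hind' l 0 v₁ (by rw [hhe]; simp)).2.2

end

theorem corollary2p4 {K : Type*} [Field K] [IsAlgClosed K] [CharZero K]
    (u v h : MvPolynomial (Fin 3) K)
    (hu : u ∈ MvPolynomial.supported K ({0, 1} : Set (Fin 3)))
    (hh : h ∈ MvPolynomial.supported K ({0, 1} : Set (Fin 3)))
    (h0 : ∀ i, MvPolynomial.eval (0 : Fin 3 → K) (![u, v, h] i) = 0)
    (hind : LinearIndependent K ![u, v, h])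
    (hnil : IsNilpotent (polyJacobian ![u, v, h]))
    (hdeg : MvPolynomial.degreeOf 1 u ≤ 7 ∨ MvPolynomial.degreeOf 1 u = 9 ∨
      MvPolynomial.degreeOf 1 h ≤ 7 ∨ MvPolynomial.degreeOf 1 h = 9) :
    HasClassifiedForm u v h := by
  exact hasClassifiedForm_of_isNilpotent hu hh h0 hind hnil
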